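/- Let $\kappa$ be an uncountable cardinal such that $\kappa^{<\kappa}=\kappa$, where $\kappa^{<\kappa}=\sup_{\lambda<\kappa}\kappa^{\lambda}$. Conventions. A graph is a set with a symmetric irreflexive binary relation; a tournament is a set with an asymmetric binary relation such that any two distinct points are related in exactly one direction. For a class $\mathcal C$ among graphs, partial orders, linear orders and tournaments, the *random* member of $\mathcal C$ of cardinality $\kappa$ is the Fraïssé limit of the class of all members of $\mathcal C$ of cardinality less than $\kappa$. That is, it is a structure $M\in\mathcal C$ with $|M|=\kappa$ such that every member of $\mathcal C$ of cardinality less than $\kappa$ is isomorphic to a substructure of $M$, and every isomorphism between two substructures of $M$ of cardinality less than $\kappa$ extends to an automorphism of $M$. (Substructures are subsets with the restricted relation.) The random group of cardinality $\kappa$ is the group $M$ with $|M|=\kappa$ such that every group generated by fewer than $\kappa$ elements is isomorphic to a subgroup of $M$, and every isomorphism between two subgroups of $M$, each generated by fewer than $\kappa$ elements, extends to an automorphism of $M$. (Substructures of a group are its subgroups.) Every automorphism group carries the topology of pointwise convergence, the underlying structure being discrete. A topological group $G$ *continuously embeds* into a topological group $H$ if there is an injective continuous group homomorphism $G\to H$;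 it *homeomorphically embeds* if there is a group homomorphism $G\to H$ that is a homeomorphism onto its image. The group $\mathrm{Aut}(M)$ is *universal* if for every substructure $A\subseteq M$ the group $\mathrm{Aut}(A)$ homeomorphically embeds into $\mathrm{Aut}(M)$. **Theorem.** Let $M$ be one of the following structures: the random graph, the random partial order, the random linear order, the random tournament or the random group of cardinality $\kappa$. Then $\mathrm{Aut}(M)$ is not universal. Moreover, there is a substructure $A\subseteq M$ such that $\mathrm{Aut}(A)$ does not continuously embed into $\mathrm{Aut}(M)$. -/

import Mathlib

open Cardinal

universe u v w

/-- The topology of pointwise convergence on a type `F` of self-maps of the discrete space `M`: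
the topology induced from the product topology on `M → M`, where `M` is discrete. -/
abbrev pointwiseTopology (F : Type v) (M : Type w) [FunLike F M M] : TopologicalSpace F :=
  TopologicalSpace.induced (fun f : F => (f : M → M))
    (@Pi.topologicalSpace M (fun _ => M) (fun _ => ⊥))

/-- `G` (a group acting by self-maps on `A`) continuously embeds into `H` (a group acting by
self-maps on `M`): there is an injective group homomorphism `G →* H` that is continuous for the
topologies of pointwise convergence. -/
def ContinuouslyEmbeds (G : Type*) (A : Type*) (H : Type*) (M : Type*)
    [Group G] [FunLike G A A] [Group H] [FunLike H M M] : Prop :=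
  ∃ e : G →* H, Function.Injective e ∧
    @Continuous G H (pointwiseTopology G A) (pointwiseTopology H M) e

/-- `G` homeomorphically embeds into `H`: there is a group homomorphism `G →* H` that is a
homeomorphism onto its image, for the topologies of pointwise convergence. -/
def HomeomorphicallyEmbeds (G : Type*) (A : Type*) (H : Type*) (M : Type*)
    [Group G] [FunLike G A A] [Group H] [FunLike H M M] : Prop :=
  ∃ e : G →* H,
    @Topology.IsEmbedding G H (pointwiseTopology G A) (pointwiseTopology H M) e

/-! ### Structures with one binary relation -/

/-- The substructure of `(M, r)` on a subset `A`: the restriction of `r` to `A`. -/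
abbrev inducedRel {M : Type u} (r : M → M → Prop) (A : Set M) : A → A → Prop :=
  Subrel r (· ∈ A)

/-- The automorphism group of `(M, r)`, with composition as multiplication. -/
abbrev RelAut {M : Type u} (r : M → M → Prop) : Type u := r ≃r r

/-- `(M, r)` is the random structure of cardinality `κ` of the (hereditary) class `C`, that is,
the Fraïssé limit of the class of members of `C` of cardinality less than `κ`:
it is a member of `C` of cardinality `κ`, every member of `C` of cardinality less than `κ` embeds
into it, and every isomorphism between two substructures of cardinality less than `κ` extends to an
automorphism. -/
structure IsRandomRel (κ : Cardinal.{u}) (C : ∀ α : Type u, (α → α → Prop) → Prop)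
    {M : Type u} (r : M → M → Prop) : Prop where
  mem : C M r
  card_eq : #M = κ
  universal : ∀ (N : Type u) (s : N → N → Prop), C N s → #N < κ → Nonempty (s ↪r r)
  homogeneous : ∀ (A B : Set M), #A < κ → #B < κ →
    ∀ f : inducedRel r A ≃r inducedRel r B, ∃ g : RelAut r, ∀ a : A, g (a : M) = (f a : M)

/-- `Aut(M, r)` is universal: for every substructure `A` of `M`, the group `Aut(A)`
homeomorphically embeds into `Aut(M)`. -/
def RelAutIsUniversal {M : Type u} (r : M → M → Prop) : Prop :=
  ∀ A : Set M, HomeomorphicallyEmbeds (RelAut (inducedRel r A)) A (RelAut r) M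

/-- The relation is the adjacency relation of a simple graph. -/
def IsGraphRel (α : Type u) (r : α → α → Prop) : Prop :=
  ∃ G : SimpleGraph α, G.Adj = r

/-- The relation is the edge relation of a tournament: an oriented graph in which any two distinct
vertices are joined by an edge. -/
def IsTournamentRel (α : Type u) (r : α → α → Prop) : Prop :=
  (∀ a b, r a b → ¬ r b a) ∧ ∀ a b, a ≠ b → r a b ∨ r b a

/-- `G` is the random graph of cardinality `κ`. -/
def IsRandomGraph (κ : Cardinal.{u}) {M : Type u} (G : SimpleGraph M) : Prop :=
  IsRandomRel κ IsGraphRel G.Adj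

/-- `M` is the random partial order of cardinality `κ`. -/
def IsRandomPartialOrder (κ : Cardinal.{u}) (M : Type u) [PartialOrder M] : Prop :=
  IsRandomRel κ (fun α s => IsPartialOrder α s) (fun x y : M => x ≤ y)

/-- `M` is the random linear order of cardinality `κ`. -/
def IsRandomLinearOrder (κ : Cardinal.{u}) (M : Type u) [LinearOrder M] : Prop :=
  IsRandomRel κ (fun α s => IsLinearOrder α s) (fun x y : M => x ≤ y)

/-- `(M, r)` is the random tournament of cardinality `κ`. -/
def IsRandomTournament (κ : Cardinal.{u}) {M : Type u} (r : M → M → Prop) : Prop :=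
  IsRandomRel κ IsTournamentRel r

/-! ### Groups -/

/-- The group `G` is generated by fewer than `κ` elements. -/
def GeneratedByLT (κ : Cardinal.{u}) (G : Type u) [Group G] : Prop :=
  ∃ S : Set G, #S < κ ∧ Subgroup.closure S = ⊤

/-- `G` is the random group of cardinality `κ`, that is, the Fraïssé limit of the class of groups
generated by fewer than `κ` elements. -/
structure IsRandomGroup (κ : Cardinal.{u}) (G : Type u) [Group G] : Prop where
  card_eq : #G = κ
  universal : ∀ (N : Type u) [Group N], GeneratedByLT κ N →
    ∃ f : N →* G, Function.Injective f
  homogeneous : ∀ (A B : Subgroup G), GeneratedByLT κ A → GeneratedByLT κ B →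
    ∀ f : A ≃* B, ∃ g : MulAut G, ∀ a : A, g (a : G) = (f a : G)

/-- `Aut(G)` is universal: for every subgroup `A` of `G`, the group `Aut(A)` homeomorphically
embeds into `Aut(G)`. -/
def MulAutIsUniversal (G : Type u) [Group G] : Prop :=
  ∀ A : Subgroup G, HomeomorphicallyEmbeds (MulAut A) A (MulAut G) G

/-! The obstruction is `Aut(ℚ, <)`. Each class has a countable member on which this group acts
faithfully with open point stabilizers: the empty graph or the order on `ℚ`, or the free group on
`ℚ`. Let `A ⊆ M` be a copy of it. A continuous embedding of `Aut(A)` into `Aut(M)` would make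
`Aut(ℚ, <)` act nontrivially on `M`, with every point having a finite support in `ℚ`.

Moving one rational of a minimal support of a non-fixed point gives an injective family `φ` in `M`,
indexed by an interval of `ℚ` and indiscernible for pairs. Cut the interval at an irrational. No `y`
in `M` can recognize this cut: its finite support misses a neighbourhood of the cut, so some
automorphism fixes `y` and carries a `φ s` from below to a `φ t` above
(`HasOpenStabilizers.exists_family`). But `κ` is uncountable, so `M` realizes one-point extensions
of countable substructures (`IsRandomRel.exists_realization`), and for groups prescribed commutation
(`IsRandomGroup.exists_commute_iff`). These supply a `y` that recognizes the cut, a contradiction.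
-/

/-! ### Order automorphisms of the rationals -/

/-- Every finite partial automorphism of `ℚ` extends to an order automorphism. -/
theorem exists_orderIso_extending_partialIso (f : Order.PartialIso ℚ ℚ) :
    ∃ g : ℚ ≃o ℚ, ∀ p ∈ f.val, g p.1 = p.2 := by
  -- Back-and-forth: an ideal through `f` meeting all these cofinal sets is defined at, and takes,
  -- every rational.
  let D : ℚ ⊕ ℚ → Order.Cofinal (Order.PartialIso ℚ ℚ) := fun p =>
    Sum.recOn p (Order.PartialIso.definedAtLeft ℚ) (Order.PartialIso.definedAtRight ℚ)
  let I : Order.Ideal (Order.PartialIso ℚ ℚ) := Order.idealOfCofinals f D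
  let F a := Order.PartialIso.funOfIdeal a I (Order.cofinal_meets_idealOfCofinals _ D (Sum.inl a))
  let G b := Order.PartialIso.invOfIdeal b I (Order.cofinal_meets_idealOfCofinals _ D (Sum.inr b))
  refine ⟨OrderIso.ofCmpEqCmp (fun a => (F a).val) (fun b => (G b).val) fun a b => ?_, ?_⟩
  · rcases (F a).prop with ⟨f, hf, ha⟩
    rcases (G b).prop with ⟨g, hg, hb⟩
    rcases I.directed _ hf _ hg with ⟨m, _, fm, gm⟩
    exact m.prop (a, _) (fm ha) (_, b) (gm hb)
  · intro p hp
    change (F p.1).val = p.2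
    rcases (F p.1).prop with ⟨g, hg, ha⟩
    rcases I.directed _ hg _ (Order.mem_idealOfCofinals f D) with ⟨m, _, gm, fm⟩
    have h := m.prop _ (gm ha) _ (fm hp)
    rw [cmp_self_eq_eq] at h
    exact (cmp_eq_eq_iff _ _).1 h.symm

/-- `q` and `r` lie in the same component of the complement of `E`. -/
def SameComponent (E : Finset ℚ) (q r : ℚ) : Prop :=
  ∀ e ∈ E, (e < q ∧ e < r) ∨ (q < e ∧ r < e)

/-- Sending `q` to `r`, `q'` to `r'` and fixing `E` is a finite partial isomorphism, since no point
of `E` separates a point from its image. -/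
theorem exists_orderIso_fixing_pair {E : Finset ℚ} {q q' r r' : ℚ} (h : SameComponent E q r)
    (h' : SameComponent E q' r') (hq : q < q') (hr : r < r') :
    ∃ g : ℚ ≃o ℚ, (∀ e ∈ E, g e = e) ∧ g q = r ∧ g q' = r' := by
  have key : ∀ {a b c d : ℚ}, (a < b ∧ c < d) ∨ (a = b ∧ c = d) ∨ (b < a ∧ d < c) →
      cmp a b = cmp c d := by
    rintro a b c d (⟨h1, h2⟩ | ⟨h1, h2⟩ | ⟨h1, h2⟩)
    · rw [h1.cmp_eq_lt, h2.cmp_eq_lt]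
    · rw [h1.cmp_eq_eq, h2.cmp_eq_eq]
    · rw [h1.cmp_eq_gt, h2.cmp_eq_gt]
  obtain ⟨g, hg⟩ := exists_orderIso_extending_partialIso
    ⟨insert (q, r) (insert (q', r') (E.image fun e => (e, e))), by
      intro p hp p' hp'
      simp only [Finset.mem_insert, Finset.mem_image] at hp hp'
      apply key
      have := lt_trichotomy p.1 p'.1
      unfold SameComponent at h h'
      grind⟩
  refine ⟨g, fun e he => hg (e, e) (by simp [he]), hg (q, r) (by simp), hg (q', r') (by simp)⟩

theorem SameComponent.exists_gt {E : Finset ℚ} {q : ℚ} (hq : q ∉ E) :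
    ∃ r, q < r ∧ SameComponent E q r := by
  obtain ⟨r, h1, h2⟩ := Order.exists_between_finsets {q} (E.filter (q < ·)) (by simp)
  refine ⟨r, by simpa using h1, fun e he => ?_⟩
  simp only [Finset.mem_singleton, forall_eq, Finset.mem_filter, and_imp] at h1 h2
  rcases lt_trichotomy e q with h | h | h
  · exact Or.inl ⟨h, h.trans h1⟩
  · exact absurd (h ▸ he) hq
  · exact Or.inr ⟨h, h2 e he h⟩

theorem exists_orderIso_fixing {E : Finset ℚ} {q r : ℚ} (h : SameComponent E q r) :
    ∃ g : ℚ ≃o ℚ, (∀ e ∈ E, g e = e) ∧ g q = r := by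
  have hq : q ∉ E := fun hq => by have := h q hq; grind
  have hr : r ∉ E := fun hr => by have := h r hr; grind
  obtain ⟨q', hqq', hq'⟩ := SameComponent.exists_gt hq
  obtain ⟨r', hrr', hr'⟩ := SameComponent.exists_gt hr
  have h' : SameComponent E q' r' := fun e he => by
    have := h e he; have := hq' e he; have := hr' e he; grind
  obtain ⟨g, hg, h1, -⟩ := exists_orderIso_fixing_pair h h' hqq' hrr'
  exact ⟨g, hg, h1⟩

/-- Two rationals on different sides of an irrational cut, close enough to the cut not to be
separated otherwise by a given finite set. -/
theorem exists_sameComponent_btwn {ξ : ℝ} (hξ : Irrational ξ) {a b : ℚ} (ha : (a : ℝ) < ξ)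
    (hb : ξ < b) (E : Finset ℚ) :
    ∃ s t : ℚ, a < s ∧ (s : ℝ) < ξ ∧ ξ < t ∧ t < b ∧ SameComponent E s t := by
  classical
  let lo : Finset ℚ := insert a (E.filter fun e => (e : ℝ) < ξ)
  let hi : Finset ℚ := insert b (E.filter fun e => ξ < (e : ℝ))
  have hlo : lo.Nonempty := Finset.insert_nonempty _ _
  have hhi : hi.Nonempty := Finset.insert_nonempty _ _
  have h1 : (lo.max' hlo : ℝ) < ξ := by
    have := lo.max'_mem hlo
    rcases Finset.mem_insert.1 this with h | h
    · rwa [h]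
    · exact (Finset.mem_filter.1 h).2
  have h2 : ξ < (hi.min' hhi : ℝ) := by
    have := hi.min'_mem hhi
    rcases Finset.mem_insert.1 this with h | h
    · rwa [h]
    · exact (Finset.mem_filter.1 h).2
  obtain ⟨s, hs, hs'⟩ := exists_rat_btwn h1
  obtain ⟨t, ht, ht'⟩ := exists_rat_btwn h2
  have hs2 : ∀ e ∈ lo, e < s := fun e he =>
    (lo.le_max' e he).trans_lt (by exact_mod_cast hs)
  have ht2 : ∀ e ∈ hi, t < e := fun e he =>
    lt_of_lt_of_le (by exact_mod_cast ht') (hi.min'_le e he)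
  have hst : s < t := by exact_mod_cast hs'.trans ht
  refine ⟨s, t, hs2 a (by simp [lo]), hs', ht, ht2 b (by simp [hi]), fun e he => ?_⟩
  rcases lt_trichotomy (e : ℝ) ξ with h | h | h
  · have := hs2 e (by simp [lo, he, h])
    exact Or.inl ⟨this, this.trans hst⟩
  · exact absurd h (hξ.ne_rat e).symm
  · have := ht2 e (by simp [hi, he, h])
    exact Or.inr ⟨hst.trans this, this⟩

/-! ### Actions of `Aut(ℚ, <)` with open stabilizers -/

/-- An action of `Aut(ℚ, <)` whose point stabilizers are open. -/
def HasOpenStabilizers (M : Type*) [MulAction (ℚ ≃o ℚ) M] : Prop :=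
  ∀ x : M, ∃ F : Finset ℚ, ∀ g : ℚ ≃o ℚ, (∀ q ∈ F, g q = q) → g • x = x

/-- A nontrivial action of `Aut(ℚ, <)` with open stabilizers contains an indiscernible family
indexed by an interval of `ℚ` and an irrational cut of that family which is not preserved by the
stabilizer of any point. -/
theorem HasOpenStabilizers.exists_family {M : Type*} [MulAction (ℚ ≃o ℚ) M]
    (hM : HasOpenStabilizers M) (hne : ∃ (g : ℚ ≃o ℚ) (x : M), g • x ≠ x) :
    ∃ (J : Set ℚ) (φ : J → M) (S : Set J), Function.Injective φ ∧ IsLowerSet S ∧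
      (∀ q q' r r' : J, q < q' → r < r' → ∃ g : ℚ ≃o ℚ, g • φ q = φ r ∧ g • φ q' = φ r') ∧
      (∀ (E : Finset J) (t : J), t ∉ E → ∃ g : ℚ ≃o ℚ,
        (∀ s ∈ E, g • φ s = φ s) ∧ g • φ t ≠ φ t) ∧
      ∀ y : M, ∃ g : ℚ ≃o ℚ, g • y = y ∧ ∃ s ∈ S, ∃ t ∉ S, g • φ s = φ t := by
  classical
  obtain ⟨g₀, x, hg₀⟩ := hne
  -- `P F` says that `F` supports `x`. A minimal support is nonempty because `x` is moved.
  let P : Finset ℚ → Prop := fun F => ∀ g : ℚ ≃o ℚ, (∀ q ∈ F, g q = q) → g • x = x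
  obtain ⟨F, hF, hmin⟩ : ∃ F, P F ∧ ∀ E, E ⊂ F → ¬ P E := by
    obtain ⟨F, hF⟩ := (WellFounded.has_min (r := fun E F : Finset ℚ => E ⊂ F)
      Finset.isWellFounded_ssubset.wf {F | P F} (hM x))
    exact ⟨F, hF.1, fun E hE hP => hF.2 E hP hE⟩
  obtain ⟨f, hf⟩ : F.Nonempty := by
    by_contra h
    rw [Finset.not_nonempty_iff_eq_empty] at h
    exact hg₀ (hF g₀ (by simp [h]))
  set E := F.erase f with hE
  have hfE : f ∉ E := Finset.notMem_erase f F
  obtain ⟨k, hkE, hkx⟩ : ∃ k : ℚ ≃o ℚ, (∀ e ∈ E, k e = e) ∧ k • x ≠ x := by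
    have := hmin E (Finset.erase_ssubset hf)
    simpa [P] using this
  let J : Set ℚ := {q | SameComponent E f q}
  have hJ : ∀ {q r : ℚ}, q ∈ J → r ∈ J → SameComponent E q r := by
    intro q r hq hr e he
    have := hq e he; have := hr e he; grind
  have hfJ : f ∈ J := fun e he => by
    have : e ≠ f := fun h => hfE (h ▸ he)
    grind
  choose γ hγE hγ using fun q : J => exists_orderIso_fixing q.2
  let φ : J → M := fun q => γ q • x
  -- `(γ r)⁻¹ * g * γ q` fixes `E` and `f`, that is, the support `F`, hence fixes `x`.
  have hφ : ∀ (g : ℚ ≃o ℚ) (q r : J), (∀ e ∈ E, g e = e) → g q = r → g • φ q = φ r := by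
    intro g q r hg hqr
    have hfix : ∀ e ∈ F, ((γ r)⁻¹ * (g * γ q)) e = e := by
      intro e he
      rw [RelIso.mul_apply, RelIso.mul_apply]
      change (γ r).symm _ = e
      rw [OrderIso.symm_apply_eq]
      by_cases hef : e = f
      · rw [hef, hγ, hγ, hqr]
      · have : e ∈ E := Finset.mem_erase.2 ⟨hef, he⟩
        rw [hγE _ _ this, hγE _ _ this, hg _ this]
    have := hF _ hfix
    rw [mul_smul, mul_smul, inv_smul_eq_iff] at this
    exact this
  -- One increasing pair with distinct values forces this for all, as pairs are conjugate over `E`.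
  have hinj_aux : ∀ (k : ℚ ≃o ℚ) (q r : J), (∀ e ∈ E, k e = e) → k q = r → q < r →
      φ q ≠ φ r → ∀ q' r' : J, q' < r' → φ q' ≠ φ r' := by
    intro k q r hk hqr hlt hne q' r' hlt' heq
    obtain ⟨g, hgE, h1, h2⟩ := exists_orderIso_fixing_pair (hJ q'.2 q.2) (hJ r'.2 r.2) hlt' hlt
    apply hne
    rw [← hφ g q' q hgE h1, ← hφ g r' r hgE h2, heq]
  have hlt_ne : ∀ q r : J, q < r → φ q ≠ φ r := by
    have hx : φ ⟨f, hfJ⟩ = x := hF _ fun e he => by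
      by_cases hef : e = f
      · rw [hef]; exact hγ ⟨f, hfJ⟩
      · exact hγE _ _ (Finset.mem_erase.2 ⟨hef, he⟩)
    have hkJ : k f ∈ J := fun e he => by
      have h1 := hfJ e he
      have h2 := hkE e he
      rcases h1 with h1 | h1
      · exact Or.inl ⟨h1.1, by rw [← h2]; exact k.lt_iff_lt.2 h1.1⟩
      · exact Or.inr ⟨h1.1, by rw [← h2]; exact k.lt_iff_lt.2 h1.1⟩
    have hk1 := hφ k ⟨f, hfJ⟩ ⟨k f, hkJ⟩ hkE rfl
    have hk2 : φ ⟨f, hfJ⟩ ≠ φ ⟨k f, hkJ⟩ := by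
      rw [← hk1, hx]; exact hkx.symm
    rcases lt_trichotomy (⟨f, hfJ⟩ : J) ⟨k f, hkJ⟩ with h | h | h
    · exact hinj_aux k _ _ hkE rfl h hk2
    · exact absurd (congrArg φ h) hk2
    · exact hinj_aux k⁻¹ ⟨k f, hkJ⟩ ⟨f, hfJ⟩ (fun e he => by
        change k.symm e = e
        rw [OrderIso.symm_apply_eq, hkE e he]) (k.symm_apply_apply f) h hk2.symm
  -- `f` and `t₀` both lie in the convex set `J`, so `J` contains rationals arbitrarily close to `ξ`
  -- on either side.
  obtain ⟨t₀, hft₀, ht₀⟩ := SameComponent.exists_gt hfE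
  obtain ⟨ξ, hξ, hξ1, hξ2⟩ := exists_irrational_btwn (show (f : ℝ) < t₀ by exact_mod_cast hft₀)
  have hinj : Function.Injective φ := by
    intro q r hqr
    rcases lt_trichotomy q r with h | h | h
    · exact absurd hqr (hlt_ne _ _ h)
    · exact h
    · exact absurd hqr.symm (hlt_ne _ _ h)
  refine ⟨J, φ, {q | ((q : ℚ) : ℝ) < ξ}, hinj, ?_, ?_, ?_, ?_⟩
  · intro q r hrq hq
    have h : ((r : ℚ) : ℝ) ≤ ((q : ℚ) : ℝ) := by exact_mod_cast hrq
    exact h.trans_lt hq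
  · intro q q' r r' hq hr
    obtain ⟨g, hgE, h1, h2⟩ := exists_orderIso_fixing_pair (hJ q.2 r.2) (hJ q'.2 r'.2) hq hr
    exact ⟨g, hφ g q r hgE h1, hφ g q' r' hgE h2⟩
  · intro E' t ht
    have htE : (t : ℚ) ∉ E ∪ E'.image (fun s : J => (s : ℚ)) := by
      intro h
      rcases Finset.mem_union.1 h with h | h
      · have := t.2 _ h; grind
      · obtain ⟨s, hs, hst⟩ := Finset.mem_image.1 h
        exact ht (Subtype.ext hst ▸ hs)
    obtain ⟨t', htt', ht'⟩ := SameComponent.exists_gt htE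
    have ht'J : t' ∈ J := fun e he => by
      have := t.2 e he
      have := ht' e (Finset.mem_union_left _ he)
      grind
    obtain ⟨g, hg, hgt⟩ := exists_orderIso_fixing ht'
    have hgE : ∀ e ∈ E, g e = e := fun e he => hg e (Finset.mem_union_left _ he)
    refine ⟨g, fun s hs => hφ g s s hgE
      (hg _ (Finset.mem_union_right _ (Finset.mem_image_of_mem _ hs))), ?_⟩
    rw [hφ g t ⟨t', ht'J⟩ hgE hgt]
    exact (hlt_ne t ⟨t', ht'J⟩ htt').symm
  · intro y
    obtain ⟨F', hF'⟩ := hM y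
    obtain ⟨s, t, hs, hsξ, hξt, ht, hst⟩ := exists_sameComponent_btwn hξ hξ1 hξ2 (E ∪ F')
    have hsJ : s ∈ J := fun e he => by
      have := ht₀ e he
      have := hst e (Finset.mem_union_left _ he)
      grind
    have htJ : t ∈ J := fun e he => by
      have := ht₀ e he
      have := hst e (Finset.mem_union_left _ he)
      grind
    obtain ⟨g, hg, hgs⟩ := exists_orderIso_fixing hst
    exact ⟨g, hF' g fun q hq => hg q (Finset.mem_union_right _ hq), ⟨s, hsJ⟩, hsξ, ⟨t, htJ⟩,
      not_lt.2 hξt.le, hφ g _ _ (fun e he => hg e (Finset.mem_union_left _ he)) hgs⟩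

/-! ### From continuous embeddings to actions -/

section Topology

variable {G A H M : Type*} [Group G] [FunLike G A A] [Group H] [FunLike H M M]

theorem HomeomorphicallyEmbeds.continuouslyEmbeds (h : HomeomorphicallyEmbeds G A H M) :
    ContinuouslyEmbeds G A H M := by
  obtain ⟨e, he⟩ := h
  let := pointwiseTopology G A
  let := pointwiseTopology H M
  exact ⟨e, he.injective, he.continuous⟩

/-- The stabilizer of `x` is open since `M` is discrete. Its preimage is a neighbourhood of `1`, so
it contains the pointwise stabilizer of a finite set. -/
theorem exists_finset_of_continuous_pointwiseTopology (h1 : ∀ a : A, (1 : G) a = a)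
    (h1' : ∀ x : M, (1 : H) x = x) {e : G →* H}
    (he : @Continuous G H (pointwiseTopology G A) (pointwiseTopology H M) e) (x : M) :
    ∃ F : Finset A, ∀ g : G, (∀ a ∈ F, g a = a) → e g x = x := by
  let : TopologicalSpace A := ⊥
  let : TopologicalSpace M := ⊥
  have : DiscreteTopology A := ⟨rfl⟩
  have : DiscreteTopology M := ⟨rfl⟩
  let := pointwiseTopology G A
  let := pointwiseTopology H M
  have hopen : IsOpen {g : G | e g x = x} := by
    have hev : Continuous fun h : H => h x := (continuous_apply x).comp continuous_induced_dom
    exact (isOpen_discrete {x}).preimage (hev.comp he)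
  obtain ⟨U, hU, hUe⟩ := isOpen_induced_iff.1 hopen
  have h1U : ((1 : G) : A → A) ∈ U := by
    change (1 : G) ∈ (fun f : G => (f : A → A)) ⁻¹' U
    rw [hUe]
    simp [h1']
  obtain ⟨F, u, hu, huU⟩ := isOpen_pi_iff.1 hU _ h1U
  refine ⟨F, fun g hg => ?_⟩
  have : g ∈ (fun f : G => (f : A → A)) ⁻¹' U := huU fun a ha => by
    have := (hu a ha).2
    rw [h1] at this
    change g a ∈ u a
    rwa [hg a ha]
  rwa [hUe] at this

/-- If `Aut(ℚ, <)` acts faithfully and continuously through `G`, then a continuous embedding of `G`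
into `H` yields a nontrivial continuous action through `H`. -/
theorem ContinuouslyEmbeds.exists_mulAction (h : ContinuouslyEmbeds G A H M)
    (h1 : ∀ a : A, (1 : G) a = a) (h1' : ∀ x : M, (1 : H) x = x)
    (hmul : ∀ (h k : H) (x : M), (h * k) x = h (k x))
    (ι : (ℚ ≃o ℚ) →* G) (hι : Function.Injective ι)
    (hιc : ∀ a : A, ∃ F : Finset ℚ, ∀ g : ℚ ≃o ℚ, (∀ q ∈ F, g q = q) → ι g a = a) :
    ∃ _ : MulAction (ℚ ≃o ℚ) M, (∀ g : ℚ ≃o ℚ, ∃ k : H, ∀ x : M, g • x = k x) ∧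
      HasOpenStabilizers M ∧ ∃ (g : ℚ ≃o ℚ) (x : M), g • x ≠ x := by
  classical
  obtain ⟨e, hinj, he⟩ := h
  let _ : MulAction (ℚ ≃o ℚ) M :=
    { smul := fun g x => e (ι g) x
      one_smul := fun x => by change e (ι 1) x = x; rw [map_one, map_one, h1']
      mul_smul := fun g k x => by
        change e (ι (g * k)) x = e (ι g) (e (ι k) x); rw [map_mul, map_mul, hmul] }
  refine ⟨inferInstance, fun g => ⟨e (ι g), fun x => rfl⟩, fun x => ?_, ?_⟩
  · obtain ⟨F, hF⟩ := exists_finset_of_continuous_pointwiseTopology h1 h1' he x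
    choose Q hQ using hιc
    exact ⟨F.biUnion Q, fun g hg => hF _ fun a ha => hQ a g fun q hq =>
      hg q (Finset.mem_biUnion.2 ⟨a, ha, hq⟩)⟩
  · by_contra hcon
    push Not at hcon
    obtain ⟨g, hg⟩ := exists_orderIso_fixing (E := ∅) (q := 0) (r := 1) (fun e he => by simp at he)
    have : g = 1 := hι (hinj (DFunLike.coe_injective (funext fun x => by
      rw [map_one, map_one, h1']; exact hcon g x)))
    rw [this] at hg
    exact absurd hg.2 (by simp)

end Topology

/-! ### Graphs, tournaments and orders -/

section Relations

variable {κ : Cardinal.{u}} {C : ∀ α : Type u, (α → α → Prop) → Prop} {M : Type u}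
  {r : M → M → Prop}

/-- The random structure realizes every one-point extension of a countable substructure. -/
theorem IsRandomRel.exists_realization (h : IsRandomRel κ C r) (hκ : ℵ₀ < κ) {D : Set M}
    (hD : D.Countable) (s : Option D → Option D → Prop) (hs : C _ s)
    (hsr : ∀ a b : D, s (some a) (some b) ↔ r a b) :
    ∃ y : M, ∀ d : D, (r y d ↔ s none (some d)) ∧ (r d y ↔ s (some d) none) := by
  have := hD.to_subtype
  -- Embed the extension anywhere in `M`, then use homogeneity to carry its copy `B` of `D` back
  -- onto `D`; the new point goes along.
  obtain ⟨f⟩ := h.universal _ s hs ((mk_le_aleph0 (α := Option D)).trans_lt hκ)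
  let B : Set M := Set.range fun d : D => f (some d)
  have hinj : Function.Injective fun d : D => f (some d) :=
    f.injective.comp (Option.some_injective _)
  have hB : B.Countable := Set.countable_range _
  have := hB.to_subtype
  let i : inducedRel r B ≃r inducedRel r D :=
    { toEquiv := (Equiv.ofInjective _ hinj).symm
      map_rel_iff' := by
        rintro ⟨_, a, rfl⟩ ⟨_, b, rfl⟩
        have ha := Equiv.ofInjective_symm_apply hinj a
        have hb := Equiv.ofInjective_symm_apply hinj b
        change r ((Equiv.ofInjective _ hinj).symm ⟨_, _⟩ : D)
          ((Equiv.ofInjective _ hinj).symm ⟨_, _⟩ : D) ↔ r (f (some a)) (f (some b))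
        rw [ha, hb, f.map_rel_iff, hsr] }
  obtain ⟨g, hg⟩ := h.homogeneous B D ((mk_le_aleph0 (α := B)).trans_lt hκ)
    ((mk_le_aleph0 (α := D)).trans_lt hκ) i
  have hgd : ∀ d : D, g (f (some d)) = d := fun d => by
    rw [hg ⟨f (some d), d, rfl⟩]
    exact congrArg Subtype.val (Equiv.ofInjective_symm_apply hinj d)
  refine ⟨g (f none), fun d => ?_⟩
  rw [← hgd d, g.map_rel_iff, f.map_rel_iff, g.map_rel_iff, f.map_rel_iff]
  exact ⟨Iff.rfl, Iff.rfl⟩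

/-- If the rationals with an `Aut(ℚ, <)`-invariant relation embed into the random structure, and
`Aut(ℚ, <)` does not act nontrivially and continuously on it, then it has a substructure whose
automorphism group does not embed continuously. -/
theorem IsRandomRel.exists_not_continuouslyEmbeds (h : IsRandomRel κ C r) (hκ : ℵ₀ < κ)
    (s : ℚ → ℚ → Prop) (hs : ∀ (g : ℚ ≃o ℚ) (a b : ℚ), s (g a) (g b) ↔ s a b)
    (hC : C (ULift.{u} ℚ) fun a b => s a.down b.down)
    (hno : ∀ [MulAction (ℚ ≃o ℚ) M],
      (∀ (g : ℚ ≃o ℚ) (x y : M), r (g • x) (g • y) ↔ r x y) → HasOpenStabilizers M →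
      ¬ ∃ (g : ℚ ≃o ℚ) (x : M), g • x ≠ x) :
    ∃ A : Set M, ¬ ContinuouslyEmbeds (RelAut (inducedRel r A)) A (RelAut r) M := by
  obtain ⟨f⟩ := h.universal _ _ hC ((mk_le_aleph0 (α := ULift.{u} ℚ)).trans_lt hκ)
  let j : ℚ → M := fun q => f ⟨q⟩
  have hj : Function.Injective j := f.injective.comp ULift.up_injective
  let A : Set M := Set.range j
  let c : ℚ ≃ A := Equiv.ofInjective j hj
  have hc : ∀ q, (c q : M) = f ⟨q⟩ := fun q => rfl
  have hrc : ∀ p q : ℚ, r (c p) (c q) ↔ s p q := fun p q => by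
    rw [hc, hc, f.map_rel_iff]
  have hrc' : ∀ a b : A, r a b ↔ s (c.symm a) (c.symm b) := fun a b => by
    rw [← hrc, c.apply_symm_apply, c.apply_symm_apply]
  let ι : (ℚ ≃o ℚ) →* RelAut (inducedRel r A) :=
    { toFun := fun g =>
        { toEquiv := c.symm.trans (g.toEquiv.trans c)
          map_rel_iff' := by
            intro a b
            change r (c (g (c.symm a))) (c (g (c.symm b))) ↔ r a b
            rw [hrc, hs, hrc'] }
      map_one' := RelIso.ext fun a => c.apply_symm_apply a
      map_mul' := fun g k => RelIso.ext fun a => by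
        change c (g (k (c.symm a))) = c (g (c.symm (c (k (c.symm a)))))
        rw [c.symm_apply_apply] }
  have hι : ∀ g a, ι g a = c (g (c.symm a)) := fun g a => rfl
  refine ⟨A, fun hA => ?_⟩
  obtain ⟨_, hact, hopen, hne⟩ := hA.exists_mulAction (fun _ => rfl) (fun _ => rfl)
    (fun _ _ _ => rfl) ι
    (fun g k hgk => RelIso.ext fun q => by
      have := DFunLike.congr_fun hgk (c q)
      rw [hι, hι, c.symm_apply_apply] at this
      exact c.injective this)
    (fun a => ⟨{c.symm a}, fun g hg => by
      rw [hι, hg _ (Finset.mem_singleton_self _), c.apply_symm_apply]⟩)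
  refine hno (fun g x y => ?_) hopen hne
  obtain ⟨k, hk⟩ := hact g
  rw [hk, hk, k.map_rel_iff]

theorem not_relAutIsUniversal
    (h : ∃ A : Set M, ¬ ContinuouslyEmbeds (RelAut (inducedRel r A)) A (RelAut r) M) :
    ¬ RelAutIsUniversal r ∧
      ∃ A : Set M, ¬ ContinuouslyEmbeds (RelAut (inducedRel r A)) A (RelAut r) M :=
  ⟨fun hu => h.elim fun A hA => hA (hu A).continuouslyEmbeds, h⟩

/-- The substructure is an independent set indexed by `ℚ`. The contradictory vertex `y` is adjacent
to `φ q` exactly for `q ∈ S`. -/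
theorem IsRandomGraph.exists_not_continuouslyEmbeds (hκ : ℵ₀ < κ) {G : SimpleGraph M}
    (hG : IsRandomGraph κ G) :
    ∃ A : Set M, ¬ ContinuouslyEmbeds (RelAut (inducedRel G.Adj A)) A (RelAut G.Adj) M := by
  refine IsRandomRel.exists_not_continuouslyEmbeds hG hκ (fun _ _ => False) (fun _ _ _ => Iff.rfl)
    ⟨⊥, by ext; simp⟩ ?_
  intro _ hinv hopen hne
  obtain ⟨J, φ, S, hφ, -, -, -, hS⟩ := hopen.exists_family hne
  have hD : (Set.range φ).Countable := Set.countable_range _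
  let K : SimpleGraph (Option (Set.range φ)) :=
    { Adj := fun a b => match a, b with
        | none, none => False
        | none, some d => (d : M) ∈ φ '' S
        | some d, none => (d : M) ∈ φ '' S
        | some a, some b => G.Adj a b
      symm := ⟨by rintro (_ | a) (_ | b) h <;> first | exact h | exact G.symm.symm _ _ h⟩
      loopless := ⟨by rintro (_ | a) h <;> first | exact h | exact G.loopless.irrefl _ h⟩ }
  obtain ⟨y, hy⟩ := hG.exists_realization hκ hD K.Adj ⟨K, rfl⟩ fun a b => Iff.rfl
  have hy' : ∀ q, G.Adj y (φ q) ↔ q ∈ S := fun q =>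
    ((hy ⟨φ q, q, rfl⟩).1).trans hφ.mem_set_image
  obtain ⟨g, hg, s, hs, t, ht, hst⟩ := hS y
  have := hinv g y (φ s)
  rw [hg, hst, hy', hy'] at this
  exact ht (this.2 hs)

theorem IsRandomTournament.exists_not_continuouslyEmbeds (hκ : ℵ₀ < κ)
    (hr : IsRandomTournament κ r) :
    ∃ A : Set M, ¬ ContinuouslyEmbeds (RelAut (inducedRel r A)) A (RelAut r) M := by
  refine IsRandomRel.exists_not_continuouslyEmbeds hr hκ (· < ·) (fun g _ _ => g.lt_iff_lt)
    ⟨fun a b h => h.asymm, fun a b h => lt_or_gt_of_ne fun h' => h (ULift.ext _ _ h')⟩ ?_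
  intro _ hinv hopen hne
  obtain ⟨J, φ, S, hφ, -, -, -, hS⟩ := hopen.exists_family hne
  have hD : (Set.range φ).Countable := Set.countable_range _
  let s : Option (Set.range φ) → Option (Set.range φ) → Prop := fun a b => match a, b with
    | none, none => False
    | none, some d => (d : M) ∈ φ '' S
    | some d, none => (d : M) ∉ φ '' S
    | some a, some b => r a b
  have hs : IsTournamentRel _ s := by
    constructor
    · rintro (_ | a) (_ | b) h
      · exact fun h => h
      · exact fun h' => h' h
      · exact h
      · exact hr.mem.1 _ _ h
    · rintro (_ | a) (_ | b) h
      · exact absurd rfl h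
      · exact em _
      · exact (em _).symm
      · exact hr.mem.2 _ _ fun h' => h (congrArg some (Subtype.ext h'))
  obtain ⟨y, hy⟩ := IsRandomRel.exists_realization hr hκ hD s hs fun a b => Iff.rfl
  have hy' : ∀ q, r y (φ q) ↔ q ∈ S := fun q =>
    ((hy ⟨φ q, q, rfl⟩).1).trans hφ.mem_set_image
  obtain ⟨g, hg, s, hs, t, ht, hst⟩ := hS y
  have := hinv g y (φ s)
  rw [hg, hst, hy', hy'] at this
  exact ht (this.2 hs)

/-- A nontrivial continuous order preserving action of `Aut(ℚ, <)` has a countable set with a lower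
subset that is not cut off by any point. -/
theorem HasOpenStabilizers.exists_lower_subset [PartialOrder M] [MulAction (ℚ ≃o ℚ) M]
    (hM : HasOpenStabilizers M) (hinv : ∀ (g : ℚ ≃o ℚ) (x y : M), g • x ≤ g • y ↔ x ≤ y)
    (hne : ∃ (g : ℚ ≃o ℚ) (x : M), g • x ≠ x) :
    ∃ (D : Set M) (L : Set D), D.Countable ∧ IsLowerSet L ∧
      ∀ y : M, ∃ d : D, ¬ ((d : M) ≤ y ↔ d ∈ L) := by
  obtain ⟨J, φ, S, hφ, hS, hpair, -, hcut⟩ := hM.exists_family hne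
  -- A point can lie above exactly one side of the cut only if that side is closed downwards in the
  -- family, so `T` is the side that is.
  suffices h : ∃ T : Set J, (T = S ∨ T = Sᶜ) ∧ ∀ p q, φ p ≤ φ q → q ∈ T → p ∈ T by
    obtain ⟨T, hT, hlow⟩ := h
    refine ⟨Set.range φ, {d | (d : M) ∈ φ '' T}, Set.countable_range _, ?_, fun y => ?_⟩
    · rintro ⟨_, q, rfl⟩ ⟨_, p, rfl⟩ hpq hq
      exact Set.mem_image_of_mem _ (hlow p q hpq (hφ.mem_set_image.1 hq))
    · by_contra hcon
      push Not at hcon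
      have hy : ∀ q, φ q ≤ y ↔ q ∈ T := fun q => (hcon ⟨φ q, q, rfl⟩).trans hφ.mem_set_image
      obtain ⟨g, hg, s, hs, t, ht, hst⟩ := hcut y
      have := hinv g (φ s) y
      rw [hg, hst, hy, hy] at this
      rcases hT with rfl | rfl
      · exact ht (this.2 hs)
      · exact this.1 ht hs
  -- By indiscernibility, a single reversed pair makes `φ` order reversing, and the upper half of
  -- the indices is then the lower side. Otherwise `φ` never reverses, and `S` works.
  by_cases h : ∃ p q : J, p < q ∧ φ q ≤ φ p
  · obtain ⟨p, q, hpq, hle⟩ := h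
    refine ⟨Sᶜ, Or.inr rfl, fun p' q' hle' hq' hp' => ?_⟩
    have hlt : p' < q' := lt_of_not_ge fun hqp => hq' (hS hqp hp')
    obtain ⟨g, hg1, hg2⟩ := hpair p q p' q' hpq hlt
    have hle2 := (hinv g _ _).2 hle
    rw [hg1, hg2] at hle2
    exact hlt.ne (hφ (le_antisymm hle' hle2))
  · push Not at h
    refine ⟨S, Or.inl rfl, fun p q hle hq => ?_⟩
    by_contra hp
    exact h q p (lt_of_not_ge fun hpq => hp (hS hpq hq)) hle

theorem IsRandomPartialOrder.exists_not_continuouslyEmbeds (hκ : ℵ₀ < κ) [PartialOrder M]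
    (hM : IsRandomPartialOrder κ M) :
    ∃ A : Set M, ¬ ContinuouslyEmbeds (RelAut (inducedRel (fun x y : M => x ≤ y) A)) A
        (RelAut (fun x y : M => x ≤ y)) M := by
  refine IsRandomRel.exists_not_continuouslyEmbeds hM hκ (· ≤ ·) (fun g _ _ => g.le_iff_le)
    { refl := fun a => le_refl _
      trans := fun a b c => le_trans
      antisymm := fun a b h h' => ULift.ext _ _ (le_antisymm h h') } ?_
  intro _ hinv hopen hne
  obtain ⟨D, L, hD, hL, hcut⟩ := hopen.exists_lower_subset hinv hne
  -- The new point lies above exactly `L` and below nothing in `D`.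
  let s : Option D → Option D → Prop := fun a b => match a, b with
    | none, none => True
    | none, some _ => False
    | some d, none => d ∈ L
    | some a, some b => a ≤ b
  have hs : IsPartialOrder _ s :=
    { refl := by rintro (_ | a); exacts [trivial, le_refl a]
      trans := by
        rintro (_ | a) (_ | b) (_ | c) h h'
        exacts [trivial, h', trivial, h, h, h'.elim, hL h h', le_trans h h']
      antisymm := by
        rintro (_ | a) (_ | b) h h'
        exacts [rfl, h.elim, h'.elim, congrArg some (le_antisymm h h')] }
  obtain ⟨y, hy⟩ := IsRandomRel.exists_realization hM hκ hD s hs fun a b => Iff.rfl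
  obtain ⟨d, hd⟩ := hcut y
  exact hd (hy d).2

theorem IsRandomLinearOrder.exists_not_continuouslyEmbeds (hκ : ℵ₀ < κ) [LinearOrder M]
    (hM : IsRandomLinearOrder κ M) :
    ∃ A : Set M, ¬ ContinuouslyEmbeds (RelAut (inducedRel (fun x y : M => x ≤ y) A)) A
        (RelAut (fun x y : M => x ≤ y)) M := by
  refine IsRandomRel.exists_not_continuouslyEmbeds hM hκ (· ≤ ·) (fun g _ _ => g.le_iff_le)
    { refl := fun a => le_refl _
      trans := fun a b c => le_trans
      antisymm := fun a b h h' => ULift.ext _ _ (le_antisymm h h')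
      total := fun a b => le_total _ _ } ?_
  intro _ hinv hopen hne
  obtain ⟨D, L, hD, hL, hcut⟩ := hopen.exists_lower_subset hinv hne
  -- By totality the new point must fill the cut: above `L`, below its complement.
  let s : Option D → Option D → Prop := fun a b => match a, b with
    | none, none => True
    | none, some d => d ∉ L
    | some d, none => d ∈ L
    | some a, some b => a ≤ b
  have hs : IsLinearOrder _ s :=
    { refl := by rintro (_ | a); exacts [trivial, le_refl a]
      trans := by
        rintro (_ | a) (_ | b) (_ | c) h h'
        exacts [trivial, h', trivial, fun hc => h (hL h' hc), h,
          (le_total a c).resolve_right fun hca => h' (hL hca h), hL h h', le_trans h h']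
      antisymm := by
        rintro (_ | a) (_ | b) h h'
        exacts [rfl, absurd h' h, absurd h h', congrArg some (le_antisymm h h')]
      total := by
        rintro (_ | a) (_ | b)
        exacts [Or.inl trivial, (em _).symm, em _, le_total a b] }
  obtain ⟨y, hy⟩ := IsRandomRel.exists_realization hM hκ hD s hs fun a b => Iff.rfl
  obtain ⟨d, hd⟩ := hcut y
  exact hd (hy d).2

end Relations

/-! ### The random group -/

section Groups

variable {κ : Cardinal.{u}} {M : Type u} [Group M]

/-- A word uses finitely many generators. This reduces independence of the family to finite sets of
indices. -/
theorem Subgroup.exists_finset_of_mem_closure_image {ι G : Type*} [Group G] {φ : ι → G} {S : Set ι}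
    {w : G} (hw : w ∈ Subgroup.closure (φ '' S)) :
    ∃ F : Finset ι, (F : Set ι) ⊆ S ∧ w ∈ Subgroup.closure (φ '' (F : Set ι)) := by
  classical
  induction hw using Subgroup.closure_induction with
  | mem x hx =>
    obtain ⟨i, hi, rfl⟩ := hx
    exact ⟨{i}, by simpa using hi, Subgroup.subset_closure ⟨i, by simp, rfl⟩⟩
  | one => exact ⟨∅, by simp, one_mem _⟩
  | mul x y _ _ hx hy =>
    obtain ⟨F, hF, hxF⟩ := hx
    obtain ⟨F', hF', hyF⟩ := hy
    refine ⟨F ∪ F', by simp [hF, hF'], mul_mem (Subgroup.closure_mono ?_ hxF)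
      (Subgroup.closure_mono ?_ hyF)⟩ <;> exact Set.image_mono (by simp)
  | inv x _ hx =>
    obtain ⟨F, hF, hxF⟩ := hx
    exact ⟨F, hF, inv_mem hxF⟩

theorem generatedByLT_closure (hκ : ℵ₀ < κ) {X : Set M} (hX : X.Countable) :
    GeneratedByLT κ (Subgroup.closure X) := by
  refine ⟨_, ?_, Subgroup.closure_closure_coe_preimage⟩
  have := (hX.preimage (Subtype.val_injective (p := (· ∈ Subgroup.closure X)))).to_subtype
  exact mk_le_aleph0.trans_lt hκ

/-- In the random group, for every countable set `X` and subgroup `C` there is an element that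
commutes with exactly those members of `X` that lie in `C`. -/
theorem IsRandomGroup.exists_commute_iff (h : IsRandomGroup κ M) (hκ : ℵ₀ < κ) {X : Set M}
    (hX : X.Countable) (C : Subgroup M) :
    ∃ y : M, ∀ x ∈ X, Commute y x ↔ x ∈ C := by
  classical
  let D : Subgroup M := Subgroup.closure X
  -- `D` acts by left translation on two copies of itself, while `τ` swaps the copies over `D ∩ C`.
  -- Translation by `d` preserves `D ∩ C` exactly when `d ∈ C`, so this is when it commutes with
  -- `τ`.
  let σ : D →* Equiv.Perm (D × Bool) :=
    { toFun := fun d => Equiv.prodCongr (Equiv.mulLeft d) (Equiv.refl _)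
      map_one' := by ext <;> simp
      map_mul' := fun a b => by ext <;> simp [mul_assoc] }
  have hσ : ∀ d x b, σ d (x, b) = (d * x, b) := fun _ _ _ => rfl
  have hσinj : Function.Injective σ := fun a b hab => by
    have := congrArg (fun p : Equiv.Perm (D × Bool) => (p (1, true)).1) hab
    simpa [hσ] using this
  let t : D × Bool → D × Bool := fun p => if (p.1 : M) ∈ C then (p.1, !p.2) else p
  have ht : Function.Involutive t := by
    rintro ⟨x, b⟩
    by_cases hx : (x : M) ∈ C <;> simp [t, hx]
  let τ : Equiv.Perm (D × Bool) := ht.toPerm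
  have hτ : ∀ p, τ p = t p := fun _ => rfl
  have hcomm : ∀ d : D, Commute τ (σ d) ↔ (d : M) ∈ C := by
    intro d
    constructor
    · intro hc
      by_contra hd
      have := congrArg (fun p : Equiv.Perm (D × Bool) => (p (1, true)).2) hc.eq
      simp [hσ, hτ, t, hd, one_mem] at this
    · intro hd
      refine Equiv.ext ?_
      rintro ⟨x, b⟩
      by_cases hx : (x : M) ∈ C <;> simp [hσ, hτ, t, hx, Subgroup.mul_mem_cancel_left C hd]
  let X' : Set D := Subtype.val ⁻¹' X
  have hX' : X'.Countable := hX.preimage Subtype.val_injective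
  have hX'D : Subgroup.closure X' = ⊤ := Subgroup.closure_closure_coe_preimage
  -- Countably many generators suffice to contain `τ` and all of `σ D`, so `N` embeds in `M`.
  let N : Subgroup (Equiv.Perm (D × Bool)) := Subgroup.closure (insert τ (σ '' X'))
  have hτN : τ ∈ N := Subgroup.subset_closure (Set.mem_insert _ _)
  have hσN : ∀ d, σ d ∈ N := by
    have : Subgroup.map σ ⊤ ≤ N := by
      rw [← hX'D, MonoidHom.map_closure]
      exact Subgroup.closure_mono (Set.subset_insert _ _)
    exact fun d => this ⟨d, trivial, rfl⟩
  obtain ⟨f, hf⟩ := h.universal N (generatedByLT_closure hκ ((hX'.image _).insert _))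
  let j : D →* M := f.comp (σ.codRestrict N hσN)
  have hj : Function.Injective j :=
    hf.comp fun a b hab => hσinj (congrArg Subtype.val hab)
  have hjB : GeneratedByLT κ j.range := by
    rw [MonoidHom.range_eq_map, ← hX'D, MonoidHom.map_closure]
    exact generatedByLT_closure hκ (hX'.image _)
  obtain ⟨g, hg⟩ := h.homogeneous j.range D hjB (generatedByLT_closure hκ hX)
    (MonoidHom.ofInjective hj).symm
  have hgj : ∀ d : D, g (j d) = d := fun d => by
    rw [hg ⟨j d, d, rfl⟩]
    exact congrArg Subtype.val ((MonoidHom.ofInjective hj).symm_apply_apply d)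
  refine ⟨g (f ⟨τ, hτN⟩), fun x hx => ?_⟩
  have hxD : x ∈ D := Subgroup.subset_closure hx
  rw [← hcomm ⟨x, hxD⟩]
  constructor
  · intro hc
    rw [show x = g (j ⟨x, hxD⟩) from (hgj ⟨x, hxD⟩).symm] at hc
    have h1 : f (⟨τ, hτN⟩ * ⟨σ ⟨x, hxD⟩, hσN _⟩) = f (⟨σ ⟨x, hxD⟩, hσN _⟩ * ⟨τ, hτN⟩) := by
      rw [map_mul, map_mul]
      apply g.injective
      rw [map_mul, map_mul]
      exact hc.eq
    exact congrArg Subtype.val (hf h1)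
  · intro hc
    have h1 : Commute (⟨τ, hτN⟩ : N) ⟨σ ⟨x, hxD⟩, hσN _⟩ := Subtype.ext hc.eq
    have h2 := (h1.map f).map g
    rwa [show g (f ⟨σ ⟨x, hxD⟩, hσN _⟩) = x from hgj ⟨x, hxD⟩] at h2

/-- The substructure is a free group on `ℚ`, with `Aut(ℚ, <)` permuting the generators. Stabilizers
are open because each word involves finitely many of them. -/
theorem IsRandomGroup.exists_not_continuouslyEmbeds (hκ : ℵ₀ < κ) (h : IsRandomGroup κ M) :
    ∃ A : Subgroup M, ¬ ContinuouslyEmbeds (MulAut A) A (MulAut M) M := by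
  classical
  obtain ⟨f, hf⟩ := h.universal (FreeGroup (ULift.{u} ℚ))
    ⟨Set.range FreeGroup.of, mk_range_le.trans_lt (mk_le_aleph0.trans_lt hκ),
      FreeGroup.closure_range_of _⟩
  let c : FreeGroup (ULift.{u} ℚ) ≃* f.range := MonoidHom.ofInjective hf
  let e : (ℚ ≃o ℚ) → FreeGroup (ULift.{u} ℚ) →* FreeGroup (ULift.{u} ℚ) :=
    fun g => FreeGroup.map fun q => ⟨g q.down⟩
  have he1 : ∀ w, e 1 w = w := fun w => FreeGroup.map.id w
  have hemul : ∀ g k w, e (g * k) w = e g (e k w) := fun g k w =>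
    (FreeGroup.map.comp (fun q : ULift.{u} ℚ => (⟨k q.down⟩ : ULift.{u} ℚ))
      (fun q : ULift.{u} ℚ => (⟨g q.down⟩ : ULift.{u} ℚ)) w).symm
  have heof : ∀ g q, e g (FreeGroup.of q) = FreeGroup.of ⟨g q.down⟩ := fun g q => FreeGroup.map.of
  have hesupp : ∀ w, ∃ F : Finset ℚ, ∀ g : ℚ ≃o ℚ, (∀ q ∈ F, g q = q) → e g w = w := by
    intro w
    induction w using FreeGroup.induction_on with
    | C1 => exact ⟨∅, fun g _ => map_one _⟩
    | of q => exact ⟨{q.down}, fun g hg => by rw [heof, hg _ (Finset.mem_singleton_self _)]⟩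
    | inv_of q hq =>
      obtain ⟨F, hF⟩ := hq
      exact ⟨F, fun g hg => by rw [map_inv, hF g hg]⟩
    | mul x y hx hy =>
      obtain ⟨F, hF⟩ := hx
      obtain ⟨F', hF'⟩ := hy
      exact ⟨F ∪ F', fun g hg => by
        rw [map_mul, hF g fun q hq => hg q (Finset.mem_union_left _ hq),
          hF' g fun q hq => hg q (Finset.mem_union_right _ hq)]⟩
  let ι : (ℚ ≃o ℚ) →* MulAut f.range :=
    { toFun := fun g => c.symm.trans
        (({ toFun := e g
            invFun := e g⁻¹
            left_inv := fun w => by rw [← hemul, inv_mul_cancel, he1]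
            right_inv := fun w => by rw [← hemul, mul_inv_cancel, he1]
            map_mul' := map_mul _ } : FreeGroup (ULift.{u} ℚ) ≃* FreeGroup (ULift.{u} ℚ)).trans c)
      map_one' := MulEquiv.ext fun a => by
        change c (e 1 (c.symm a)) = a
        rw [he1, c.apply_symm_apply]
      map_mul' := fun g k => MulEquiv.ext fun a => by
        change c (e (g * k) (c.symm a)) = c (e g (c.symm (c (e k (c.symm a)))))
        rw [hemul, c.symm_apply_apply] }
  have hι : ∀ g a, ι g a = c (e g (c.symm a)) := fun _ _ => rfl
  refine ⟨f.range, fun hA => ?_⟩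
  obtain ⟨_, hact, hopen, hne⟩ := hA.exists_mulAction (fun _ => rfl) (fun _ => rfl)
    (fun _ _ _ => rfl) ι
    (fun g k hgk => RelIso.ext fun q => by
      have := DFunLike.congr_fun hgk (c (FreeGroup.of ⟨q⟩))
      rw [hι, hι, c.symm_apply_apply, heof, heof] at this
      exact congrArg ULift.down (FreeGroup.of_injective (c.injective this)))
    (fun a => by
      obtain ⟨F, hF⟩ := hesupp (c.symm a)
      exact ⟨F, fun g hg => by rw [hι, hF g hg, c.apply_symm_apply]⟩)
  obtain ⟨J, φ, S, hφ, -, -, hindep, hS⟩ := hopen.exists_family hne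
  -- What commutes with `y` is a subgroup, so the cut must survive generation: an automorphism
  -- fixing finitely many `φ s` but moving `φ q` shows that they do not generate `φ q`.
  have hmemS : ∀ q, φ q ∈ Subgroup.closure (φ '' S) ↔ q ∈ S := by
    refine fun q => ⟨fun hq => ?_, fun hq => Subgroup.subset_closure (Set.mem_image_of_mem _ hq)⟩
    by_contra hqS
    obtain ⟨F, hFS, hqF⟩ := Subgroup.exists_finset_of_mem_closure_image hq
    obtain ⟨g, hg, hgq⟩ := hindep F q fun hqF => hqS (hFS hqF)
    obtain ⟨k, hk⟩ := hact g
    refine hgq ?_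
    rw [hk]
    have hfix : Set.EqOn k.toMonoidHom (MonoidHom.id M) (φ '' F) := by
      rintro _ ⟨s, hs, rfl⟩
      exact (hk _).symm.trans (hg s hs)
    exact MonoidHom.eqOn_closure hfix hqF
  obtain ⟨y, hy⟩ := h.exists_commute_iff hκ (Set.countable_range φ) (Subgroup.closure (φ '' S))
  have hy' : ∀ q, Commute y (φ q) ↔ q ∈ S := fun q => (hy _ ⟨q, rfl⟩).trans (hmemS q)
  obtain ⟨g, hg, s, hs, t, ht, hst⟩ := hS y
  obtain ⟨k, hk⟩ := hact g
  have := ((hy' s).2 hs).map k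
  rw [← hk, ← hk, hg, hst, hy'] at this
  exact ht this

theorem not_mulAutIsUniversal
    (h : ∃ A : Subgroup M, ¬ ContinuouslyEmbeds (MulAut A) A (MulAut M) M) :
    ¬ MulAutIsUniversal M ∧ ∃ A : Subgroup M, ¬ ContinuouslyEmbeds (MulAut A) A (MulAut M) M :=
  ⟨fun hu => h.elim fun A hA => hA (hu A).continuouslyEmbeds, h⟩

end Groups

theorem mainTheorem1 (κ : Cardinal.{u}) (hκ : ℵ₀ < κ) (hpow : κ ^< κ = κ) (M : Type u) :
    (∀ G : SimpleGraph M, IsRandomGraph κ G →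
      ¬ RelAutIsUniversal G.Adj ∧
      ∃ A : Set M, ¬ ContinuouslyEmbeds (RelAut (inducedRel G.Adj A)) A (RelAut G.Adj) M) ∧
    (∀ [PartialOrder M], IsRandomPartialOrder κ M →
      ¬ RelAutIsUniversal (fun x y : M => x ≤ y) ∧
      ∃ A : Set M, ¬ ContinuouslyEmbeds (RelAut (inducedRel (fun x y : M => x ≤ y) A)) A
        (RelAut (fun x y : M => x ≤ y)) M) ∧
    (∀ [LinearOrder M], IsRandomLinearOrder κ M →
      ¬ RelAutIsUniversal (fun x y : M => x ≤ y) ∧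
      ∃ A : Set M, ¬ ContinuouslyEmbeds (RelAut (inducedRel (fun x y : M => x ≤ y) A)) A
        (RelAut (fun x y : M => x ≤ y)) M) ∧
    (∀ r : M → M → Prop, IsRandomTournament κ r →
      ¬ RelAutIsUniversal r ∧
      ∃ A : Set M, ¬ ContinuouslyEmbeds (RelAut (inducedRel r A)) A (RelAut r) M) ∧
    (∀ [Group M], IsRandomGroup κ M →
      ¬ MulAutIsUniversal M ∧
      ∃ A : Subgroup M, ¬ ContinuouslyEmbeds (MulAut A) A (MulAut M) M) :=
  ⟨fun _ h => not_relAutIsUniversal (IsRandomGraph.exists_not_continuouslyEmbeds hκ h),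
    fun h => not_relAutIsUniversal (IsRandomPartialOrder.exists_not_continuouslyEmbeds hκ h),
    fun h => not_relAutIsUniversal (IsRandomLinearOrder.exists_not_continuouslyEmbeds hκ h),
    fun _ h => not_relAutIsUniversal (IsRandomTournament.exists_not_continuouslyEmbeds hκ h),
    fun h => not_mulAutIsUniversal (IsRandomGroup.exists_not_continuouslyEmbeds hκ h)⟩
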